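/- Let $\mathcal I$ be a countable commutative additively cancellative semiring with a non-trivial parity function, i.e. a non-zero homomorphism of additive monoids $p:\mathcal I\to\mathbb Z_2$. Let $V=\bigoplus_{i\in\mathcal I}V_i$ be a finite-dimensional real $\mathcal I$-graded vector space with $V_0=0$. Let $\mathrm S(V)=\bigoplus_k \mathrm S^k(V)$ be the quotient of the tensor algebra of $V$ by the relations $v\otimes w=(-1)^{p(ij)}\,w\otimes v$ for $v\in V_i$, $w\in V_j$, and let $\overline{\mathrm S(V)}=\prod_k\mathrm S^k(V)$. An *$\mathcal I$-graded ringed space* is a topological space with a sheaf $\mathcal O$ of $\mathcal I$-graded real algebras, the restriction maps being homomorphisms of real algebras which preserve degrees. Here an $\mathcal I$-grading of an algebra $A$ is a family of subspaces $A_i$ with $1\in A_0$ and $A_iA_j\subseteq A_{i+j}$, together with linear component maps $A\to A_i$ that restrict to $\delta_{ij}$ on $A_j$ and are jointly injective (so $\bigoplus_i A_i\subseteq A\subseteq\prod_i A_i$). A morphism $\varphi=(\tilde\varphi,\varphi^*)$ of $\mathcal I$-graded ringed spaces is a morphism of ringed spaces whose ring homomorphisms $\varphi^*_U$ preserve degrees.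 A smooth manifold $M$ is regarded as the $\mathcal I$-graded ringed space $(M,C^\infty)$ concentrated in degree $0$. For $U\subseteq\mathbb R^n$ open, the *$\mathcal I$-graded domain* $\mathcal U$ is $U$ with the sheaf of smooth $\overline{\mathrm S(V)}$-valued functions (all components in the finite-dimensional spaces $\mathrm S^k(V)$ are smooth), a function being of degree $i$ if all its values are. An *$\mathcal I$-graded manifold* $\mathcal M=(M,\mathcal O)$ of dimension $n\,|\,(\dim V_i)_{i\in\mathcal I}$ over a smooth $n$-manifold $M$ is an $\mathcal I$-graded ringed space on $M$ such that every point of $M$ has an open neighbourhood $U_x$ with $(U_x,\mathcal O|_{U_x})$ isomorphic, as an $\mathcal I$-graded ringed space, to an $\mathcal I$-graded domain, through an isomorphism whose underlying map is a diffeomorphism. Then: 1. For every open $U\subseteq\mathbb R^n$ there is a unique monomorphism $\varphi:U\to\mathcal U$ with $\tilde\varphi=\mathrm{id}$. 2. For every $\mathcal I$-graded manifold $\mathcal M=(M,\mathcal O)$ there is a unique monomorphism $\varphi:M\to\mathcal M$ with $\tilde\varphi=\mathrm{id}$. In both cases $\varphi$ is a monomorphism in the category of $\mathcal I$-graded ringed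 spaces, its maps $\varphi^*_U$ are homomorphisms of real algebras, and its maps of stalks are surjective local homomorphisms; moreover $\varphi$ is the only morphism at all (monomorphic or not) with underlying map the identity. In particular, the underlying manifold of $\mathcal M$, i.e. $M$ together with a morphism $\varphi:M\to\mathcal M$ with $\tilde\varphi=\mathrm{id}$, exists and is unique. 3. For every smooth manifold $M$, every endomorphism of the sheaf of rings $C^\infty$ on $M$ is the identity. -/

import Mathlib

open CategoryTheory TopologicalSpace Opposite AlgebraicGeometry
open scoped Manifold ContDiff

noncomputable section

/-! ### Graded algebras -/

/-- `𝒜` makes the real algebra `A` into an `ℐ`-graded algebra, where infinite sums of homogeneous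
components are allowed: `1` has degree `0`, degrees add under multiplication, and there are linear
component maps `c i : A → 𝒜 i` which restrict to the Kronecker delta on homogeneous elements
and which jointly determine an element. In other words, `⨁ 𝒜 i ⊆ A ⊆ ∏ 𝒜 i`. -/
structure IsFormalGrading {ℐ : Type*} [AddCommMonoid ℐ] {A : Type*} [Ring A] [Algebra ℝ A]
    (𝒜 : ℐ → Submodule ℝ A) : Prop where
  one_mem : (1 : A) ∈ 𝒜 0
  mul_mem : ∀ {i j : ℐ} {a b : A}, a ∈ 𝒜 i → b ∈ 𝒜 j → a * b ∈ 𝒜 (i + j)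
  exists_component : ∃ c : ℐ → A →ₗ[ℝ] A,
    (∀ i a, c i a ∈ 𝒜 i) ∧ (∀ i, ∀ a ∈ 𝒜 i, c i a = a) ∧
    (∀ i j, i ≠ j → ∀ a ∈ 𝒜 i, c j a = 0) ∧ ∀ a, (∀ i, c i a = 0) → a = 0

/-! ### Graded ringed spaces -/

/-- A sheaf of `ℐ`-graded real algebras on `X`. -/
structure GradedSheaf (ℐ : Type*) [AddCommMonoid ℐ] (X : TopCat.{0}) where
  /-- the underlying sheaf of rings -/
  sheaf : X.Sheaf RingCat.{0}
  /-- every ring of sections is a real algebra -/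
  algebra : ∀ U : Opens X, Algebra ℝ (sheaf.presheaf.obj (op U))
  /-- the homogeneous sections of a given degree -/
  deg : ∀ U : Opens X, ℐ → Submodule ℝ (sheaf.presheaf.obj (op U))
  isFormalGrading : ∀ U : Opens X, IsFormalGrading (deg U)
  map_algebraMap : ∀ {U V : Opens X} (h : V ⟶ U) (r : ℝ),
    (sheaf.presheaf.map h.op).hom (algebraMap ℝ (sheaf.presheaf.obj (op U)) r) =
      algebraMap ℝ (sheaf.presheaf.obj (op V)) r
  map_deg : ∀ {U V : Opens X} (h : V ⟶ U) (i : ℐ), ∀ s ∈ deg U i,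
    (sheaf.presheaf.map h.op).hom s ∈ deg V i

attribute [instance] GradedSheaf.algebra

/-- The restriction of a sheaf of graded algebras to an open subset. -/
def GradedSheaf.restrict {ℐ : Type*} [AddCommMonoid ℐ] {X : TopCat.{0}} (𝒪 : GradedSheaf ℐ X)
    (U : Opens X) : GradedSheaf ℐ (TopCat.of U) where
  sheaf := ⟨U.isOpenEmbedding.isOpenMap.functor.op ⋙ 𝒪.sheaf.presheaf,
    TopCat.Presheaf.isSheaf_of_isOpenEmbedding (f := TopCat.ofHom ⟨_, continuous_subtype_val⟩)
      U.isOpenEmbedding 𝒪.sheaf.property⟩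
  algebra W := 𝒪.algebra (U.isOpenEmbedding.isOpenMap.functor.obj W)
  deg W := 𝒪.deg (U.isOpenEmbedding.isOpenMap.functor.obj W)
  isFormalGrading W := 𝒪.isFormalGrading (U.isOpenEmbedding.isOpenMap.functor.obj W)
  map_algebraMap h r := 𝒪.map_algebraMap (U.isOpenEmbedding.isOpenMap.functor.map h) r
  map_deg h i s hs := 𝒪.map_deg (U.isOpenEmbedding.isOpenMap.functor.map h) i s hs

/-- An `ℐ`-graded ringed space: a topological space with a sheaf of `ℐ`-graded real algebras. -/
structure GradedRingedSpace (ℐ : Type*) [AddCommMonoid ℐ] where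
  carrier : TopCat.{0}
  𝒪 : GradedSheaf ℐ carrier

namespace GradedRingedSpace

variable {ℐ : Type*} [AddCommMonoid ℐ]

/-- The underlying ringed space (the rings of sections need not be commutative). -/
def toSheafedSpace (X : GradedRingedSpace ℐ) : SheafedSpace RingCat.{0} where
  carrier := X.carrier
  presheaf := X.𝒪.sheaf.presheaf
  IsSheaf := X.𝒪.sheaf.property

/-- A morphism of graded ringed spaces `X ⟶ Y`: a morphism of ringed spaces, that is, a continuous
map `base` and a morphism `c` of sheaves of rings from `𝒪_Y` to the pushforward of `𝒪_X`, which
preserves the grading. -/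
structure Hom (X Y : GradedRingedSpace ℐ) where
  toHom : X.toSheafedSpace.toPresheafedSpace ⟶ Y.toSheafedSpace.toPresheafedSpace
  map_deg : ∀ (U : Opens Y.carrier) (i : ℐ), ∀ s ∈ Y.𝒪.deg U i,
    (toHom.c.app (op U)).hom s ∈ X.𝒪.deg ((Opens.map toHom.base).obj U) i

instance : Category (GradedRingedSpace ℐ) where
  Hom := Hom
  id X := ⟨𝟙 _, fun _ _ _ hs => hs⟩
  comp f g := ⟨f.toHom ≫ g.toHom, fun U i s hs => f.map_deg _ i _ (g.map_deg U i s hs)⟩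

variable {X Y : GradedRingedSpace ℐ}

/-- The underlying continuous map. -/
def base (φ : X ⟶ Y) : X.carrier ⟶ Y.carrier := φ.toHom.base

/-- The homomorphism `φ^*_U : 𝒪_Y(U) → 𝒪_X(φ⁻¹ U)`. -/
def app (φ : X ⟶ Y) (U : Opens Y.carrier) :
    Y.𝒪.sheaf.presheaf.obj (op U) →+*
      X.𝒪.sheaf.presheaf.obj (op ((Opens.map (base φ)).obj U)) :=
  (φ.toHom.c.app (op U)).hom

/-- The induced homomorphism of stalks `𝒪_{Y, φ(x)} → 𝒪_{X, x}`. -/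
def stalkMap (φ : X ⟶ Y) (x : X.carrier) :
    Y.𝒪.sheaf.presheaf.stalk (base φ x) →+* X.𝒪.sheaf.presheaf.stalk x :=
  (PresheafedSpace.Hom.stalkMap φ.toHom x).hom

/-- The homomorphisms of stalks are local, as for morphisms of locally ringed spaces. -/
def IsLocal (φ : X ⟶ Y) : Prop :=
  ∀ x : X.carrier, IsLocalHom (stalkMap φ x)

/-- `φ^* : 𝒪_Y → φ_* 𝒪_X` is `ℝ`-linear. -/
def IsRealLinear (φ : X ⟶ Y) : Prop :=
  ∀ (U : Opens Y.carrier) (r : ℝ), app φ U (algebraMap ℝ _ r) = algebraMap ℝ _ r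

/-- The homomorphisms of stalks are surjective. -/
def IsStalkSurjective (φ : X ⟶ Y) : Prop :=
  ∀ x : X.carrier, Function.Surjective (stalkMap φ x)

end GradedRingedSpace

/-! ### The symmetric algebra of a graded vector space and its completion -/

section Symmetric

variable {ℐ : Type*} [NonUnitalCommSemiring ℐ] (p : ℐ →+ ZMod 2)
  {V : Type} [AddCommGroup V] [Module ℝ V] (𝒱 : ℐ → Submodule ℝ V)

/-- The relations `v ⊗ w = (-1)^{p(d(v) d(w))} w ⊗ v` for homogeneous `v` and `w`. -/
inductive SymRel : TensorAlgebra ℝ V → TensorAlgebra ℝ V → Prop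
  | comm (i j : ℐ) (v w : V) (hv : v ∈ 𝒱 i) (hw : w ∈ 𝒱 j) :
      SymRel (TensorAlgebra.ι ℝ v * TensorAlgebra.ι ℝ w)
        (((-1 : ℝ) ^ (p (i * j)).val) • (TensorAlgebra.ι ℝ w * TensorAlgebra.ι ℝ v))

/-- The symmetric algebra `S(V)` of the graded vector space `V = ⨁ 𝒱 i`. -/
def GradedSym : Type := RingQuot (SymRel p 𝒱)

instance : Ring (GradedSym p 𝒱) := inferInstanceAs (Ring (RingQuot (SymRel p 𝒱)))

instance : Algebra ℝ (GradedSym p 𝒱) := inferInstanceAs (Algebra ℝ (RingQuot (SymRel p 𝒱)))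

/-- The quotient map `T(V) → S(V)`. -/
def GradedSym.mk : TensorAlgebra ℝ V →ₐ[ℝ] GradedSym p 𝒱 := RingQuot.mkAlgHom ℝ (SymRel p 𝒱)

/-- The canonical map `V → S(V)`. -/
def GradedSym.ι : V →ₗ[ℝ] GradedSym p 𝒱 :=
  (GradedSym.mk p 𝒱).toLinearMap ∘ₗ TensorAlgebra.ι ℝ

/-- The subspace `S^n(V)` of `S(V)` spanned by the products of `n` elements of `V`. -/
def symPow (n : ℕ) : Submodule ℝ (GradedSym p 𝒱) :=
  LinearMap.range (GradedSym.ι p 𝒱) ^ n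

/-- The subspace `S^n(V)_i` of `S^n(V)` spanned by the products of `n` homogeneous elements of `V`
whose degrees sum up to `i`. -/
def symDeg (n : ℕ) (i : ℐ) : Submodule ℝ (GradedSym p 𝒱) :=
  Submodule.span ℝ {a | ∃ l : List (Σ j : ℐ, 𝒱 j), l.length = n ∧
    (l.map fun v => v.1).sum = i ∧ (l.map fun v => GradedSym.ι p 𝒱 v.2.1).prod = a}

/-- The algebra of formal power series `∏ₙ S^n(V)`, with the Cauchy product. -/
def FormalSym : Subalgebra ℝ (PowerSeries (GradedSym p 𝒱)) where
  carrier := {f | ∀ n, PowerSeries.coeff n f ∈ symPow p 𝒱 n}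
  mul_mem' := by
    intro f g hf hg n
    rw [PowerSeries.coeff_mul]
    refine Submodule.sum_mem _ fun x hx => ?_
    rw [← Finset.HasAntidiagonal.mem_antidiagonal.mp hx]
    unfold symPow
    rw [pow_add]
    exact Submodule.mul_mem_mul (hf _) (hg _)
  add_mem' := by
    intro f g hf hg n
    rw [map_add]
    exact add_mem (hf n) (hg n)
  algebraMap_mem' := by
    intro r n
    rw [PowerSeries.algebraMap_apply, PowerSeries.coeff_C]
    split_ifs with h
    · subst h
      unfold symPow
      rw [pow_zero]
      exact Submodule.algebraMap_mem r
    · exact zero_mem _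

end Symmetric

section SymLemmas

variable {ℐ : Type*} [NonUnitalCommSemiring ℐ] {p : ℐ →+ ZMod 2}
  {V : Type} [AddCommGroup V] [Module ℝ V] {𝒱 : ℐ → Submodule ℝ V}

theorem symPow_fg [FiniteDimensional ℝ V] (n : ℕ) : (symPow p 𝒱 n).FG := by
  apply Submodule.FG.pow
  rw [LinearMap.range_eq_map]
  exact Module.Finite.fg_top.map _

/-- A basis expansion in `S^n(V)` with coefficients given by functionals on `S(V)`. -/
theorem symPow_expansion [FiniteDimensional ℝ V] (n : ℕ) :
    ∃ (k : ℕ) (e : Fin k → GradedSym p 𝒱) (l : Fin k → Module.Dual ℝ (GradedSym p 𝒱)),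
      ∀ a ∈ symPow p 𝒱 n, a = ∑ t, l t a • e t := by
  have : Module.Finite ℝ (symPow p 𝒱 n) := Module.Finite.iff_fg.mpr (symPow_fg n)
  let b := Module.finBasis ℝ (symPow p 𝒱 n)
  choose l hl using fun t => LinearMap.exists_extend (b.coord t)
  refine ⟨_, fun t => (b t : GradedSym p 𝒱), l, fun a ha => ?_⟩
  have h1 : ∀ t, l t a = b.repr ⟨a, ha⟩ t := fun t =>
    LinearMap.congr_fun (hl t) (⟨a, ha⟩ : symPow p 𝒱 n)
  have h2 := congrArg Subtype.val (b.sum_repr ⟨a, ha⟩)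
  simp only [h1]
  rw [Submodule.coe_sum] at h2
  exact h2.symm

theorem GradedSym.ι_comm {i j : ℐ} {v w : V} (hv : v ∈ 𝒱 i) (hw : w ∈ 𝒱 j) :
    GradedSym.ι p 𝒱 v * GradedSym.ι p 𝒱 w =
      ((-1 : ℝ) ^ (p (i * j)).val) • (GradedSym.ι p 𝒱 w * GradedSym.ι p 𝒱 v) := by
  have h : GradedSym.mk p 𝒱 _ = GradedSym.mk p 𝒱 _ :=
    RingQuot.mkAlgHom_rel ℝ (SymRel.comm (p := p) (𝒱 := 𝒱) i j v w hv hw)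
  simpa [GradedSym.ι] using h

theorem one_mem_symDeg : (1 : GradedSym p 𝒱) ∈ symDeg p 𝒱 0 0 :=
  Submodule.subset_span ⟨[], rfl, rfl, rfl⟩

theorem mul_mem_symDeg {m n : ℕ} {i j : ℐ} {a b : GradedSym p 𝒱}
    (ha : a ∈ symDeg p 𝒱 m i) (hb : b ∈ symDeg p 𝒱 n j) :
    a * b ∈ symDeg p 𝒱 (m + n) (i + j) := by
  have h := Submodule.mul_mem_mul ha hb
  unfold symDeg at h
  rw [Submodule.span_mul_span] at h
  refine Submodule.span_mono ?_ h
  rintro _ ⟨_, ⟨l, rfl, rfl, rfl⟩, _, ⟨l', rfl, rfl, rfl⟩, rfl⟩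
  exact ⟨l ++ l', by simp⟩

theorem symDeg_le {n : ℕ} {i : ℐ} : symDeg p 𝒱 n i ≤ symPow p 𝒱 n := by
  refine Submodule.span_le.mpr ?_
  rintro _ ⟨l, rfl, rfl, rfl⟩
  change _ ∈ symPow p 𝒱 l.length
  unfold symPow
  induction l with
  | nil =>
    rw [List.map_nil, List.prod_nil, List.length_nil, pow_zero]
    exact Submodule.one_le.mp le_rfl
  | cons v l ih =>
    rw [List.map_cons, List.prod_cons, List.length_cons, pow_succ']
    exact Submodule.mul_mem_mul ⟨_, rfl⟩ ih

theorem symPow_le_iSup [DecidableEq ℐ] [DirectSum.Decomposition 𝒱] (n : ℕ) :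
    symPow p 𝒱 n ≤ ⨆ i, symDeg p 𝒱 n i := by
  induction n with
  | zero =>
    refine le_trans ?_ (le_iSup _ 0)
    unfold symPow
    rw [pow_zero, Submodule.one_le]
    exact one_mem_symDeg
  | succ n ih =>
    unfold symPow at ih ⊢
    rw [pow_succ, Submodule.mul_le]
    rintro a ha _ ⟨v, rfl⟩
    have hv : GradedSym.ι p 𝒱 v ∈ ⨆ j, symDeg p 𝒱 1 j := by
      classical
      rw [← DirectSum.sum_support_decompose 𝒱 v, map_sum]
      refine Submodule.sum_mem _ fun j _ => Submodule.mem_iSup_of_mem j ?_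
      exact Submodule.subset_span ⟨[⟨j, DirectSum.decompose 𝒱 v j⟩], by simp⟩
    have h := Submodule.mul_mem_mul (ih ha) hv
    rw [Submodule.iSup_mul] at h
    refine SetLike.le_def.mp (iSup_le fun i => ?_) h
    rw [Submodule.mul_iSup]
    refine iSup_le fun j => le_trans ?_ (le_iSup _ (i + j))
    rw [Submodule.mul_le]
    exact fun x hx y hy => mul_mem_symDeg hx hy

variable [DecidableEq ℐ] [DirectSum.Decomposition 𝒱]

variable (p 𝒱) in
/-- `v ↦ ∑ᵢ vᵢ tⁱ`. -/
def symCoactι : V →ₗ[ℝ] AddMonoidAlgebra (GradedSym p 𝒱) ℐ :=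
  (DirectSum.toModule ℝ ℐ (AddMonoidAlgebra (GradedSym p 𝒱) ℐ) fun i =>
    (AddMonoidAlgebra.lsingle (R := ℝ) i) ∘ₗ GradedSym.ι p 𝒱 ∘ₗ (𝒱 i).subtype) ∘ₗ
    (DirectSum.decomposeLinearEquiv 𝒱).toLinearMap

theorem symCoactι_of_mem {i : ℐ} {v : V} (hv : v ∈ 𝒱 i) :
    symCoactι p 𝒱 v = AddMonoidAlgebra.single i (GradedSym.ι p 𝒱 v) := by
  lift v to 𝒱 i using hv
  simp [symCoactι]

variable (p 𝒱) in
/-- The coaction `S(V) → S(V)[ℐ]` which encodes the grading. -/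
def symCoact : GradedSym p 𝒱 →ₐ[ℝ] AddMonoidAlgebra (GradedSym p 𝒱) ℐ :=
  (RingQuot.liftAlgHom ℝ ⟨TensorAlgebra.lift ℝ (symCoactι p 𝒱), by
    rintro _ _ ⟨i, j, v, w, hv, hw⟩
    simp only [map_mul, map_smul, TensorAlgebra.lift_ι_apply, symCoactι_of_mem hv,
      symCoactι_of_mem hw, AddMonoidAlgebra.single_mul_single]
    rw [GradedSym.ι_comm hv hw, add_comm j i]
    simp⟩ : RingQuot (SymRel p 𝒱) →ₐ[ℝ] _)

theorem symCoact_ι (v : V) : symCoact p 𝒱 (GradedSym.ι p 𝒱 v) = symCoactι p 𝒱 v :=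
  (RingQuot.liftAlgHom_mkAlgHom_apply _ _ _ _).trans (TensorAlgebra.lift_ι_apply _ _)

theorem symCoact_of_mem {n : ℕ} {i : ℐ} {a : GradedSym p 𝒱} (ha : a ∈ symDeg p 𝒱 n i) :
    symCoact p 𝒱 a = AddMonoidAlgebra.single i a := by
  suffices h : symDeg p 𝒱 n i ≤ LinearMap.eqLocus (symCoact p 𝒱).toLinearMap
      (AddMonoidAlgebra.lsingle (R := ℝ) i) from h ha
  refine Submodule.span_le.mpr ?_
  rintro _ ⟨l, rfl, rfl, rfl⟩
  clear ha
  change symCoact p 𝒱 _ = AddMonoidAlgebra.single _ _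
  induction l with
  | nil => simpa using AddMonoidAlgebra.one_def
  | cons v l ih =>
    simp only [List.map_cons, List.prod_cons, List.sum_cons, map_mul, ih, symCoact_ι,
      symCoactι_of_mem v.2.2, AddMonoidAlgebra.single_mul_single]

variable (p 𝒱) in
/-- The projection of `S(V)` onto its part of degree `i`. -/
def symComponent (i : ℐ) : GradedSym p 𝒱 →ₗ[ℝ] GradedSym p 𝒱 where
  toFun a := (symCoact p 𝒱 a).coeff i
  map_add' a b := by simp
  map_smul' r a := by simp

theorem symComponent_self {n : ℕ} {i : ℐ} {a : GradedSym p 𝒱} (ha : a ∈ symDeg p 𝒱 n i) :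
    symComponent p 𝒱 i a = a := by
  change (symCoact p 𝒱 a).coeff i = a
  simp [symCoact_of_mem ha]

theorem symComponent_ne {n : ℕ} {i j : ℐ} (hij : i ≠ j) {a : GradedSym p 𝒱}
    (ha : a ∈ symDeg p 𝒱 n i) : symComponent p 𝒱 j a = 0 := by
  change (symCoact p 𝒱 a).coeff j = 0
  simp [symCoact_of_mem ha, hij]

theorem symComponent_mem {n : ℕ} (i : ℐ) {a : GradedSym p 𝒱} (ha : a ∈ symPow p 𝒱 n) :
    symComponent p 𝒱 i a ∈ symDeg p 𝒱 n i := by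
  suffices h : symPow p 𝒱 n ≤ (symDeg p 𝒱 n i).comap (symComponent p 𝒱 i) from h ha
  refine (symPow_le_iSup n).trans (iSup_le fun j b hb => ?_)
  rw [Submodule.mem_comap]
  by_cases hij : j = i
  · subst hij
    rwa [symComponent_self hb]
  · rw [symComponent_ne hij hb]
    exact zero_mem _

theorem eq_zero_of_symComponent {n : ℕ} {a : GradedSym p 𝒱} (ha : a ∈ symPow p 𝒱 n)
    (h : ∀ i, symComponent p 𝒱 i a = 0) : a = 0 := by
  obtain ⟨f, hf, rfl⟩ := (Submodule.mem_iSup_iff_exists_finsupp _ _).mp (symPow_le_iSup n ha)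
  refine Finset.sum_eq_zero fun j hj => ?_
  have hc := h j
  rw [Finsupp.sum, map_sum, Finset.sum_eq_single j, symComponent_self (hf j)] at hc
  · exact hc
  · exact fun k _ hkj => symComponent_ne hkj (hf k)
  · exact fun hj' => absurd hj hj'

end SymLemmas

/-! ### Smooth manifolds and graded domains as graded ringed spaces -/

section Spaces

variable (ℐ : Type*) [NonUnitalCommSemiring ℐ]
  (n : ℕ) (N : Type) [TopologicalSpace N] [ChartedSpace (EuclideanSpace ℝ (Fin n)) N]

instance smoothAlgebra (U : (Opens (TopCat.of N))ᵒᵖ) :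
    Algebra ℝ ((smoothSheafRing 𝓘(ℝ, EuclideanSpace ℝ (Fin n)) 𝓘(ℝ, ℝ) N ℝ).presheaf.obj U) :=
  inferInstanceAs
    (Algebra ℝ C^∞⟮𝓘(ℝ, EuclideanSpace ℝ (Fin n)), (unop U : Opens N); 𝓘(ℝ, ℝ), ℝ⟯)

/-- The sheaf `C^∞` of smooth real functions on `N`, concentrated in degree `0`. -/
def smoothGradedSheaf : GradedSheaf ℐ (TopCat.of N) where
  sheaf := smoothSheafRing 𝓘(ℝ, EuclideanSpace ℝ (Fin n)) 𝓘(ℝ, ℝ) N ℝ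
  algebra U := smoothAlgebra n N (op U)
  deg U i :=
    { carrier := {s | i ≠ 0 → s = 0}
      add_mem' := fun ha hb hi => by rw [ha hi, hb hi, add_zero]
      zero_mem' := fun _ => rfl
      smul_mem' := fun r s hs hi => by rw [hs hi, smul_zero] }
  isFormalGrading U :=
    { one_mem := fun h => absurd rfl h
      mul_mem := by
        intro i j a b ha hb hij
        by_cases hi : i = 0
        · have hj : j ≠ 0 := fun hj => hij (by rw [hi, hj, add_zero])
          rw [hb hj, mul_zero]
        · rw [ha hi, zero_mul]
      exists_component := by
        classical
        refine ⟨fun i => if i = 0 then LinearMap.id else 0, fun i a hi => ?_, fun i a ha => ?_,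
          fun i j hij a ha => ?_, fun a ha => ?_⟩
        · simp [hi]
        · by_cases hi : i = 0
          · simp [hi]
          · simp [hi, ha hi]
        · by_cases hj : j = 0
          · have hi : i ≠ 0 := fun hi => hij (hi.trans hj.symm)
            simp [hj, ha hi]
          · simp [hj]
        · simpa using ha 0 }
  map_algebraMap h r := rfl
  map_deg h i s hs hi := by rw [hs hi, map_zero]

/-- The manifold `N`, viewed as the graded ringed space `(N, C^∞)`. -/
def smoothSpace : GradedRingedSpace ℐ := ⟨TopCat.of N, smoothGradedSheaf ℐ n N⟩

variable {ℐ} (p : ℐ →+ ZMod 2) {V : Type} [AddCommGroup V] [Module ℝ V] [FiniteDimensional ℝ V]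
  (𝒱 : ℐ → Submodule ℝ V)

/-- A function on the open set `U` with values in the formal power series `∏ₖ S^k(V)` is smooth if
each of its components, with values in the finite dimensional vector space `S^k(V)`, is smooth,
that is, if its composition with each linear functional is smooth. -/
def IsSmoothFormal {U : Opens N} (f : U → FormalSym p 𝒱) : Prop :=
  ∀ (k : ℕ) (l : Module.Dual ℝ (GradedSym p 𝒱)),
    ContMDiff 𝓘(ℝ, EuclideanSpace ℝ (Fin n)) 𝓘(ℝ, ℝ) ∞
      fun x => l (PowerSeries.coeff k (f x).1)

/-- The algebra of smooth functions on `U` with values in the formal power series `∏ₖ S^k(V)`. -/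
def formalSections (U : Opens N) : Subalgebra ℝ (U → FormalSym p 𝒱) where
  carrier := {f | IsSmoothFormal n N p 𝒱 f}
  mul_mem' := by
    intro f g hf hg k l
    simp only [Pi.mul_apply, MulMemClass.coe_mul, PowerSeries.coeff_mul, map_sum]
    refine contMDiff_finsetSum fun x _ => ?_
    obtain ⟨m, e, d, hd⟩ := symPow_expansion (p := p) (𝒱 := 𝒱) x.1
    have h : ∀ y : U, l (PowerSeries.coeff x.1 (f y).1 * PowerSeries.coeff x.2 (g y).1) =
        ∑ t, d t (PowerSeries.coeff x.1 (f y).1) *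
          (l ∘ₗ LinearMap.mulLeft ℝ (e t)) (PowerSeries.coeff x.2 (g y).1) := by
      intro y
      conv_lhs => rw [hd _ ((f y).2 x.1)]
      simp [Finset.sum_mul]
    simp only [h]
    exact contMDiff_finsetSum fun t _ => (hf x.1 (d t)).mul (hg x.2 _)
  add_mem' := by
    intro f g hf hg k l
    simp only [Pi.add_apply, AddMemClass.coe_add, map_add]
    exact (hf k l).add (hg k l)
  algebraMap_mem' := by
    intro r k l
    exact contMDiff_const (c := l (PowerSeries.coeff k
      (algebraMap ℝ (PowerSeries (GradedSym p 𝒱)) r)))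

/-- The restriction of smooth functions to a smaller open set. -/
def formalRestrict {U W : Opens N} (h : W ≤ U) :
    formalSections n N p 𝒱 U →ₐ[ℝ] formalSections n N p 𝒱 W where
  toFun f := ⟨fun x => f.1 ⟨x.1, h x.2⟩, fun k l => (f.2 k l).comp (contMDiff_inclusion h)⟩
  map_one' := rfl
  map_mul' _ _ := rfl
  map_zero' := rfl
  map_add' _ _ := rfl
  commutes' _ := rfl

/-- The presheaf of smooth functions with values in the formal power series `∏ₖ S^k(V)`. -/
def formalPresheaf : TopCat.Presheaf RingCat.{0} (TopCat.of N) where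
  obj U := RingCat.of (formalSections n N p 𝒱 (unop U))
  map h := RingCat.ofHom (formalRestrict n N p 𝒱 (leOfHom h.unop)).toRingHom
  map_id _ := rfl
  map_comp _ _ := rfl

/-- Smoothness is a local property. -/
def formalLocalPredicate : TopCat.LocalPredicate fun _ : TopCat.of N => FormalSym p 𝒱 where
  pred {U} f := IsSmoothFormal n N p 𝒱 (U := U) f
  res {U W} i f hf := fun k l => (hf k l).comp (contMDiff_inclusion (leOfHom i))
  locality {U} f h := fun k l =>
    ((contDiffWithinAt_localInvariantProp (I := 𝓘(ℝ, EuclideanSpace ℝ (Fin n)))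
      (I' := 𝓘(ℝ, ℝ)) ∞).localPredicate N ℝ).locality _ fun x => by
        obtain ⟨W, hx, i, hW⟩ := h x
        exact ⟨W, hx, i, hW k l⟩

theorem formalPresheaf_isSheaf : (formalPresheaf n N p 𝒱).IsSheaf := by
  unfold TopCat.Presheaf.IsSheaf
  rw [CategoryTheory.Presheaf.isSheaf_iff_isSheaf_forget _ _ (CategoryTheory.forget RingCat)]
  exact (TopCat.subsheafToTypes (formalLocalPredicate n N p 𝒱)).property

/-- The smooth functions all of whose values are homogeneous of degree `i`. -/
def formalDeg (U : Opens N) (i : ℐ) : Submodule ℝ (formalSections n N p 𝒱 U) where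
  carrier := {f | ∀ x k, PowerSeries.coeff k (f.1 x).1 ∈ symDeg p 𝒱 k i}
  add_mem' := by
    intro f g hf hg x k
    exact add_mem (hf x k) (hg x k)
  zero_mem' := by
    intro x k
    exact zero_mem _
  smul_mem' := by
    intro r f hf x k
    exact Submodule.smul_mem _ r (hf x k)

theorem formalDeg_isFormalGrading [DecidableEq ℐ] [DirectSum.Decomposition 𝒱] (U : Opens N) :
    IsFormalGrading (A := formalSections n N p 𝒱 U) (formalDeg n N p 𝒱 U) where
  one_mem := by
    intro x k
    change PowerSeries.coeff k (1 : PowerSeries (GradedSym p 𝒱)) ∈ _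
    rw [PowerSeries.coeff_one]
    split_ifs with h
    · subst h
      exact one_mem_symDeg
    · exact zero_mem _
  mul_mem := by
    intro i j a b ha hb x k
    change PowerSeries.coeff k ((a.1 x).1 * (b.1 x).1) ∈ _
    rw [PowerSeries.coeff_mul]
    refine Submodule.sum_mem _ fun y hy => ?_
    rw [← Finset.HasAntidiagonal.mem_antidiagonal.mp hy]
    exact mul_mem_symDeg (ha x _) (hb x _)
  exists_component := by
    let c : ℐ → formalSections n N p 𝒱 U →ₗ[ℝ] formalSections n N p 𝒱 U := fun i =>
      { toFun := fun f =>
          ⟨fun x => ⟨PowerSeries.mk fun k => symComponent p 𝒱 i (PowerSeries.coeff k (f.1 x).1), by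
            intro k
            rw [PowerSeries.coeff_mk]
            exact symDeg_le (symComponent_mem i ((f.1 x).2 k))⟩, by
            intro k l
            simp only [PowerSeries.coeff_mk]
            exact f.2 k (l ∘ₗ symComponent p 𝒱 i)⟩
        map_add' := by
          intro f g
          ext x k
          simp
        map_smul' := by
          intro r f
          ext x k
          simp }
    have hc : ∀ i f x k, PowerSeries.coeff k ((c i f).1 x).1 =
        symComponent p 𝒱 i (PowerSeries.coeff k (f.1 x).1) := by
      intro i f x k
      exact PowerSeries.coeff_mk k fun k => symComponent p 𝒱 i (PowerSeries.coeff k (f.1 x).1)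
    refine ⟨c, fun i f x k => ?_, fun i f hf => ?_, fun i j hij f hf => ?_, fun f hf => ?_⟩
    · rw [hc]
      exact symComponent_mem i ((f.1 x).2 k)
    · ext x k
      rw [hc, symComponent_self (hf x k)]
    · ext x k
      rw [hc, symComponent_ne hij (hf x k)]
      rfl
    · ext x k
      refine eq_zero_of_symComponent ((f.1 x).2 k) fun i => ?_
      rw [← hc, hf i]
      rfl

/-- The sheaf of smooth functions on `N` with values in `∏ₖ S^k(V)`. -/
def formalGradedSheaf [DecidableEq ℐ] [DirectSum.Decomposition 𝒱] :
    GradedSheaf ℐ (TopCat.of N) where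
  sheaf := ⟨formalPresheaf n N p 𝒱, formalPresheaf_isSheaf n N p 𝒱⟩
  algebra U := inferInstanceAs (Algebra ℝ (formalSections n N p 𝒱 U))
  deg U := formalDeg n N p 𝒱 U
  isFormalGrading U := formalDeg_isFormalGrading n N p 𝒱 U
  map_algebraMap _ _ := rfl
  map_deg h _ _ hs := fun x k => hs ⟨x.1, leOfHom h x.2⟩ k

/-- The graded domain over an open subset `U` of `ℝⁿ`: the graded ringed space of smooth functions
on `U` with values in the algebra of formal power series on `V`. -/
def gradedDomain [DecidableEq ℐ] [DirectSum.Decomposition 𝒱]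
    (U : Opens (EuclideanSpace ℝ (Fin n))) : GradedRingedSpace ℐ :=
  ⟨TopCat.of U, formalGradedSheaf n U p 𝒱⟩

/-- `(M, 𝒪)` is a graded manifold of dimension `n | (dim 𝒱 i)ᵢ` over the smooth manifold `M`: every
point of `M` has an open neighbourhood `U` such that `(U, 𝒪|_U)` is isomorphic, as a graded ringed
space, to a graded domain, the underlying homeomorphism being a diffeomorphism. -/
def IsGradedManifold [DecidableEq ℐ] [DirectSum.Decomposition 𝒱]
    (M : Type) [TopologicalSpace M] [ChartedSpace (EuclideanSpace ℝ (Fin n)) M]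
    (𝒪 : GradedSheaf ℐ (TopCat.of M)) : Prop :=
  ∀ x : M, ∃ U : Opens M, x ∈ U ∧ ∃ (W : Opens (EuclideanSpace ℝ (Fin n)))
    (χ : (⟨TopCat.of U, 𝒪.restrict U⟩ : GradedRingedSpace ℐ) ≅ gradedDomain n p 𝒱 W),
    ContMDiff (M := U) (M' := W) 𝓘(ℝ, EuclideanSpace ℝ (Fin n)) 𝓘(ℝ, EuclideanSpace ℝ (Fin n)) ∞
      (GradedRingedSpace.base χ.hom).hom ∧
    ContMDiff (M := W) (M' := U) 𝓘(ℝ, EuclideanSpace ℝ (Fin n)) 𝓘(ℝ, EuclideanSpace ℝ (Fin n)) ∞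
      (GradedRingedSpace.base χ.inv).hom

end Spaces

end

/-! The underlying manifold is governed by real-valued evaluations of sections at points. Call a
family of ring homomorphisms e from the sections near x to ℝ, compatible with restriction, local if
e(s) ≠ 0 forces s to be invertible near x. A local evaluation is the only compatible evaluation
(`IsLocalAt.eq`): if e' differs from e at s, then s - e'(s) is not killed by e, hence is a unit near
x, yet e' sends it to 0. Real-linearity is automatic here, since the identity is the only ring
endomorphism of ℝ.

Uniqueness: a morphism ψ over the identity, followed by evaluation of smooth functions at x, is a
compatible evaluation, so its values are determined at every point. The same argument applied to C^∞
itself shows that its endomorphisms are trivial.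

Existence: on a graded domain, take the constant coefficient of a formal power series and the
augmentation S(V) → ℝ. This is local because a power series whose constant term is a non-zero scalar
is invertible and the coefficients of the inverse are smooth (`formalEval_isLocalAt`). Charts
transport this evaluation to a graded manifold (`SmoothEvaluation.nonempty_of_iso`). No gluing data
has to be checked, because uniqueness makes the local evaluations agree on overlaps
(`SmoothEvaluation.nonempty_of_locally`).

Monomorphy and surjectivity on stalks both come from lifting smooth functions locally to sections.
-/

noncomputable section

/-! ### Sections of sheaves of graded algebras -/

namespace GradedSheaf

variable {ℐ : Type*} [AddCommMonoid ℐ] {X : TopCat.{0}} (𝒪 : GradedSheaf ℐ X)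

/-- The sections of `𝒪` over the open set `U`. -/
abbrev sections (U : Opens X) : Type := 𝒪.sheaf.presheaf.obj (op U)

/-- The restriction of sections to a smaller open set. -/
def res {U W : Opens X} (h : W ≤ U) : 𝒪.sections U →+* 𝒪.sections W :=
  (𝒪.sheaf.presheaf.map (homOfLE h).op).hom

theorem res_res {U W T : Opens X} (h : W ≤ U) (h' : T ≤ W) (s : 𝒪.sections U) :
    𝒪.res h' (𝒪.res h s) = 𝒪.res (h'.trans h) s := by
  change (𝒪.sheaf.presheaf.map (homOfLE h).op ≫ 𝒪.sheaf.presheaf.map (homOfLE h').op).hom s = _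
  rw [← Functor.map_comp]
  rfl

theorem res_self {U : Opens X} (h : U ≤ U) (s : 𝒪.sections U) : 𝒪.res h s = s := by
  change (𝒪.sheaf.presheaf.map (𝟙 (op U))).hom s = s
  rw [CategoryTheory.Functor.map_id]
  rfl

theorem germ_res {U W : Opens X} (h : W ≤ U) {x : X} (hx : x ∈ W) (s : 𝒪.sections U) :
    𝒪.sheaf.presheaf.germ W x hx (𝒪.res h s) = 𝒪.sheaf.presheaf.germ U x (h hx) s :=
  𝒪.sheaf.presheaf.germ_res_apply (homOfLE h) x hx s

/-- A family of real-valued ring homomorphisms on the sections near `x`, compatible with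
restrictions. -/
def IsCompatibleAt (x : X) (e : ∀ U : Opens X, x ∈ U → 𝒪.sections U →+* ℝ) : Prop :=
  ∀ (U W : Opens X) (h : W ≤ U) (hx : x ∈ W) (s : 𝒪.sections U),
    e W hx (𝒪.res h s) = e U (h hx) s

/-- Sections which do not vanish at `x` under `e` are invertible near `x`. -/
def IsLocalAt (x : X) (e : ∀ U : Opens X, x ∈ U → 𝒪.sections U →+* ℝ) : Prop :=
  ∀ (U : Opens X) (hx : x ∈ U) (s : 𝒪.sections U), e U hx s ≠ 0 →
    ∃ (W : Opens X) (h : W ≤ U), x ∈ W ∧ IsUnit (𝒪.res h s)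

variable {𝒪}

/-- ℝ has no ring endomorphism besides the identity. This is why ring homomorphisms suffice
throughout and linearity is a conclusion. -/
theorem ringHom_algebraMap {U : Opens X} (e : 𝒪.sections U →+* ℝ) (r : ℝ) :
    e (algebraMap ℝ (𝒪.sections U) r) = r :=
  RingHom.congr_fun (Subsingleton.elim (e.comp (algebraMap ℝ _)) (RingHom.id ℝ)) r

/-- A local evaluation at `x` is the only one. -/
theorem IsLocalAt.eq {x : X} {e e' : ∀ U : Opens X, x ∈ U → 𝒪.sections U →+* ℝ}
    (he : 𝒪.IsLocalAt x e) (he' : 𝒪.IsCompatibleAt x e') (U : Opens X) (hx : x ∈ U)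
    (s : 𝒪.sections U) : e' U hx s = e U hx s := by
  by_contra hne
  -- Subtracting the scalar e'(s) yields a section killed by e' but not by e. Locality of e makes it
  -- a unit near x, which e' cannot kill.
  obtain ⟨W, h, hW, hu⟩ := he U hx (s - algebraMap ℝ _ (e' U hx s)) (by
    rw [map_sub, ringHom_algebraMap, sub_ne_zero]
    exact fun h => hne h.symm)
  have h1 := (hu.map (e' W hW)).ne_zero
  rw [he', map_sub, ringHom_algebraMap, sub_self] at h1
  exact h1 rfl

end GradedSheaf

/-! ### Morphisms of graded ringed spaces on sections and stalks. -/

namespace GradedRingedSpace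

variable {ℐ : Type*} [AddCommMonoid ℐ] {X Y Z : GradedRingedSpace ℐ}

theorem app_res (φ : X ⟶ Y) {U W : Opens Y.carrier} (h : W ≤ U) (s : Y.𝒪.sections U) :
    app φ W (Y.𝒪.res h s) =
      X.𝒪.res (((Opens.map (base φ)).map (homOfLE h)).le) (app φ U s) :=
  RingHom.congr_fun (congrArg RingCat.Hom.hom (φ.toHom.c.naturality (homOfLE h).op)) s

/-- The preimage of U under φ equals U only propositionally, so the restriction map serves as the
cast. It is applied to the two composites of a chart and its inverse. -/
theorem app_of_eq_id {φ : X ⟶ X} (h : φ = 𝟙 X) (U : Opens X.carrier) (s : X.𝒪.sections U) :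
    app φ U s = X.𝒪.res (U := U) (W := (Opens.map (base φ)).obj U) (by subst h; exact le_refl U)
      s := by
  subst h
  exact (X.𝒪.res_self le_rfl s).symm

theorem app_comp (φ : X ⟶ Y) (ψ : Y ⟶ Z) (U : Opens Z.carrier) (s : Z.𝒪.sections U) :
    app (φ ≫ ψ) U s = app φ ((Opens.map (base ψ)).obj U) (app ψ U s) :=
  rfl

theorem stalkMap_germ (φ : X ⟶ Y) (U : Opens Y.carrier) (x : X.carrier) (hx : base φ x ∈ U)
    (s : Y.𝒪.sections U) :
    stalkMap φ x (Y.𝒪.sheaf.presheaf.germ U (base φ x) hx s) =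
      X.𝒪.sheaf.presheaf.germ ((Opens.map (base φ)).obj U) x hx (app φ U s) :=
  RingHom.congr_fun (congrArg RingCat.Hom.hom (PresheafedSpace.stalkMap_germ φ.toHom U x hx)) s

theorem hom_ext {φ ψ : X ⟶ Y} (h : base φ = base ψ)
    (h' : ∀ (U : Opens Y.carrier) (s : Y.𝒪.sections U),
      app φ U s = X.𝒪.res (by rw [h]) (app ψ U s)) : φ = ψ := by
  obtain ⟨⟨b, c⟩, hφ⟩ := φ
  obtain ⟨⟨b', c'⟩, hψ⟩ := ψ
  change b = b' at h
  subst h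
  have : c = c' := by
    ext U s
    exact (h' U s).trans (X.𝒪.res_self le_rfl _)
  subst this
  rfl

end GradedRingedSpace

/-- Compatibility with restriction is a cocone over the neighbourhoods of x, and the stalk is their
colimit. -/
theorem GradedSheaf.IsCompatibleAt.exists_stalk {ℐ : Type*} [AddCommMonoid ℐ] {X : TopCat.{0}}
    {𝒪 : GradedSheaf ℐ X} {x : X} {e : ∀ U : Opens X, x ∈ U → 𝒪.sections U →+* ℝ}
    (he : 𝒪.IsCompatibleAt x e) :
    ∃ E : 𝒪.sheaf.presheaf.stalk x →+* ℝ, ∀ (U : Opens X) (hx : x ∈ U) (s : 𝒪.sections U),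
      E (𝒪.sheaf.presheaf.germ U x hx s) = e U hx s := by
  let c : Limits.Cocone ((OpenNhds.inclusion x).op ⋙ 𝒪.sheaf.presheaf) :=
    { pt := RingCat.of ℝ
      ι := { app := fun U => RingCat.ofHom (e (unop U).1 (unop U).2)
             naturality := fun U W i => by
              ext s
              exact he _ _ (leOfHom i.unop) _ s } }
  exact ⟨(Limits.colimit.desc _ c).hom, fun U hx s => RingHom.congr_fun
    (congrArg RingCat.Hom.hom (Limits.colimit.ι_desc c (op ⟨U, hx⟩))) s⟩

/-! ### Smooth functions -/

section SmoothSections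

variable {ℐ : Type*} [NonUnitalCommSemiring ℐ] {n : ℕ} {M : Type} [TopologicalSpace M]
  [ChartedSpace (EuclideanSpace ℝ (Fin n)) M]

/-- The extension by zero of a function on an open set. -/
def extendZero {U : Opens M} (f : U → ℝ) (x : M) : ℝ :=
  open Classical in if hx : x ∈ U then f ⟨x, hx⟩ else 0

theorem extendZero_of_mem {U : Opens M} (f : U → ℝ) {x : M} (hx : x ∈ U) :
    extendZero f x = f ⟨x, hx⟩ :=
  dif_pos hx

theorem contMDiffAt_extendZero {U : Opens M} {f : U → ℝ}
    {x : M} (hx : x ∈ U)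
    (hf : ContMDiffAt 𝓘(ℝ, EuclideanSpace ℝ (Fin n)) 𝓘(ℝ, ℝ) ∞ f ⟨x, hx⟩) :
    ContMDiffAt 𝓘(ℝ, EuclideanSpace ℝ (Fin n)) 𝓘(ℝ, ℝ) ∞ (extendZero f) x := by
  rw [← contMDiffAt_subtype_iff (x := (⟨x, hx⟩ : U))]
  convert hf using 2 with y
  exact extendZero_of_mem f y.2

theorem contMDiff_of_contMDiffAt {U : Opens M} {f : U → ℝ} {g : M → ℝ}
    (hg : ∀ x ∈ U, ContMDiffAt 𝓘(ℝ, EuclideanSpace ℝ (Fin n)) 𝓘(ℝ, ℝ) ∞ g x)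
    (hfg : ∀ x : U, f x = g x) :
    ContMDiff 𝓘(ℝ, EuclideanSpace ℝ (Fin n)) 𝓘(ℝ, ℝ) ∞ f := by
  obtain rfl : f = fun x : U => g x := funext hfg
  exact fun x => contMDiffAt_subtype_iff.mpr (hg x x.2)

variable (n M) in
/-- Evaluation of smooth functions. -/
def smoothEval (x : M) (U : Opens M) (hx : x ∈ U) :
    (smoothSheafRing 𝓘(ℝ, EuclideanSpace ℝ (Fin n)) 𝓘(ℝ, ℝ) M ℝ).presheaf.obj (op U) →+* ℝ :=
  (ContMDiffMap.evalRingHom (I := 𝓘(ℝ, EuclideanSpace ℝ (Fin n))) (I' := 𝓘(ℝ, ℝ)) (R := ℝ)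
    (n := ∞) (⟨x, hx⟩ : U))

theorem smooth_ext {U : Opens M}
    {f g : (smoothSheafRing 𝓘(ℝ, EuclideanSpace ℝ (Fin n)) 𝓘(ℝ, ℝ) M ℝ).presheaf.obj (op U)}
    (h : ∀ (x : M) (hx : x ∈ U), smoothEval n M x U hx f = smoothEval n M x U hx g) : f = g :=
  Subtype.ext (funext fun x => h x.1 x.2)

theorem smoothEval_isCompatibleAt (x : M) :
    (smoothGradedSheaf ℐ n M).IsCompatibleAt x (smoothEval n M x) :=
  fun _ _ _ _ _ => rfl

/-- The reciprocal is smooth on the open set where the function does not vanish. -/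
theorem smoothEval_isLocalAt (x : M) :
    (smoothGradedSheaf ℐ n M).IsLocalAt x (smoothEval n M x) := by
  intro U hx f hf
  have hs : ContMDiff 𝓘(ℝ, EuclideanSpace ℝ (Fin n)) 𝓘(ℝ, ℝ) ∞ f.1 := f.2
  let W : Opens M := ⟨Subtype.val '' (f.1 ⁻¹' {0}ᶜ),
    U.2.isOpenMap_subtype_val _ (isOpen_compl_singleton.preimage hs.continuous)⟩
  have hWU : W ≤ U := by
    rintro _ ⟨y, -, rfl⟩
    exact y.2
  have hW : ∀ y : W, f.1 ⟨y.1, hWU y.2⟩ ≠ 0 := by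
    rintro ⟨_, y, hy, rfl⟩
    exact hy
  let g : C^∞⟮𝓘(ℝ, EuclideanSpace ℝ (Fin n)), W; 𝓘(ℝ, ℝ), ℝ⟯ :=
    ⟨fun y => (f.1 ⟨y.1, hWU y.2⟩)⁻¹, fun y =>
      ((contDiffAt_inv ℝ (hW y)).contMDiffAt).comp y (hs.comp (contMDiff_inclusion hWU) y)⟩
  refine ⟨W, hWU, ⟨⟨x, hx⟩, hf, rfl⟩, ⟨(smoothGradedSheaf ℐ n M).res hWU f, g, ?_, ?_⟩, rfl⟩
  · exact Subtype.ext (funext fun y => mul_inv_cancel₀ (hW y))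
  · exact Subtype.ext (funext fun y => inv_mul_cancel₀ (hW y))

theorem smoothSheafRing_hom_eq_id
    (F : smoothSheafRing 𝓘(ℝ, EuclideanSpace ℝ (Fin n)) 𝓘(ℝ, ℝ) M ℝ ⟶
      smoothSheafRing 𝓘(ℝ, EuclideanSpace ℝ (Fin n)) 𝓘(ℝ, ℝ) M ℝ) : F = 𝟙 _ := by
  refine ObjectProperty.hom_ext _ (NatTrans.ext (funext fun U => ?_))
  ext f
  refine smooth_ext fun x hx => ?_
  -- Evaluation after F is a second compatible evaluation. The grading plays no role, so ℕ is an
  -- arbitrary choice of index.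
  exact (smoothEval_isLocalAt (ℐ := ℕ) x).eq
    (e' := fun U hx => (smoothEval n M x U hx).comp (F.hom.app (op U)).hom)
    (fun U W h hx s => congrArg (smoothEval n M x W hx)
      (RingHom.congr_fun (congrArg RingCat.Hom.hom (F.hom.naturality (homOfLE h).op)) s))
    (unop U) hx f

end SmoothSections

/-! ### Evaluations of graded sheaves on manifolds -/

section Evaluation

variable {ℐ : Type*} [NonUnitalCommSemiring ℐ] (n : ℕ) {M : Type} [TopologicalSpace M]
  [ChartedSpace (EuclideanSpace ℝ (Fin n)) M]

/-- A local evaluation of the sections of `𝒪` at the points of `U₀`, such that the sections become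
smooth functions and all smooth functions locally arise in this way. -/
structure SmoothEvaluation (𝒪 : GradedSheaf ℐ (TopCat.of M)) (U₀ : Opens M) where
  ev : ∀ y : M, y ∈ U₀ → ∀ U : Opens M, y ∈ U → 𝒪.sections U →+* ℝ
  isCompatibleAt : ∀ y hy, 𝒪.IsCompatibleAt (y : M) (ev y hy)
  isLocalAt : ∀ y hy, 𝒪.IsLocalAt (y : M) (ev y hy)
  ev_of_deg : ∀ (U : Opens M) (i : ℐ), i ≠ 0 → ∀ s ∈ 𝒪.deg U i, ∀ y h₀ hy, ev y h₀ U hy s = 0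
  -- Functions on all of M avoid nested subtypes of opens. The values of g outside U₀ ⊓ U are
  -- irrelevant.
  exists_contMDiffAt : ∀ (U : Opens M) (s : 𝒪.sections U), ∀ y ∈ U₀, y ∈ U → ∃ g : M → ℝ,
    ContMDiffAt 𝓘(ℝ, EuclideanSpace ℝ (Fin n)) 𝓘(ℝ, ℝ) ∞ g y ∧
      ∀ z h₀ hz, g z = ev z h₀ U hz s
  exists_section : ∀ (U : Opens M) (f : M → ℝ),
    (∀ z ∈ U, ContMDiffAt 𝓘(ℝ, EuclideanSpace ℝ (Fin n)) 𝓘(ℝ, ℝ) ∞ f z) → ∀ y ∈ U₀, y ∈ U →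
    ∃ W : Opens M, W ≤ U ∧ y ∈ W ∧ ∃ s : 𝒪.sections W, ∀ z h₀ hz, ev z h₀ W hz s = f z

variable {n}

theorem SmoothEvaluation.nonempty_of_locally {𝒪 : GradedSheaf ℐ (TopCat.of M)}
    (h : ∀ x : M, ∃ U : Opens M, x ∈ U ∧ Nonempty (SmoothEvaluation n 𝒪 U)) :
    Nonempty (SmoothEvaluation n 𝒪 ⊤) := by
  choose U hU b using h
  replace b := fun x => (b x).some
  -- Agreement on overlaps is uniqueness of the local evaluation at y. Each point may therefore use
  -- the evaluation chosen for that point.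
  have key : ∀ (x y : M) (hy : y ∈ U x) (T : Opens M) (hT : y ∈ T) (s : 𝒪.sections T),
      (b x).ev y hy T hT s = (b y).ev y (hU y) T hT s := fun x y hy T hT s =>
    ((b y).isLocalAt y (hU y)).eq ((b x).isCompatibleAt y hy) T hT s
  refine ⟨{
    ev := fun y _ => (b y).ev y (hU y)
    isCompatibleAt := fun y _ => (b y).isCompatibleAt y (hU y)
    isLocalAt := fun y _ => (b y).isLocalAt y (hU y)
    ev_of_deg := fun T i hi s hs y _ hy => (b y).ev_of_deg T i hi s hs y (hU y) hy
    exists_contMDiffAt := fun T s y _ hy => ?_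
    exists_section := fun T f hf y _ hy => ?_ }⟩
  · obtain ⟨g, hg, hgs⟩ := (b y).exists_contMDiffAt T s y (hU y) hy
    -- The evaluation used here changes from point to point, but near y it coincides with that of `b
    -- y` by `key`, which gives smoothness.
    refine ⟨extendZero fun z : T => (b z).ev z (hU z) T z.2 s, hg.congr_of_eventuallyEq ?_,
      fun z _ hz => extendZero_of_mem _ hz⟩
    filter_upwards [(U y ⊓ T).2.mem_nhds ⟨hU y, hy⟩] with z hz
    rw [extendZero_of_mem _ hz.2, hgs z hz.1 hz.2]
    exact (key y z hz.1 T hz.2 s).symm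
  · obtain ⟨W, hWT, hyW, s, hs⟩ := (b y).exists_section T f hf y (hU y) hy
    refine ⟨W ⊓ U y, inf_le_left.trans hWT, ⟨hyW, hU y⟩, 𝒪.res inf_le_left s, fun z _ hz => ?_⟩
    rw [← key y z hz.2, (b y).isCompatibleAt, hs]

/-! ### The morphism defined by a global smooth evaluation, and its properties. -/

namespace SmoothEvaluation

open GradedRingedSpace

variable {𝒪 : GradedSheaf ℐ (TopCat.of M)} (b : SmoothEvaluation n 𝒪 ⊤)

/-- The homomorphism from the sections of `𝒪` to the smooth functions. -/
def toSmooth (U : Opens M) : 𝒪.sections U →+*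
    (smoothSheafRing 𝓘(ℝ, EuclideanSpace ℝ (Fin n)) 𝓘(ℝ, ℝ) M ℝ).presheaf.obj (op U) where
  toFun s := (⟨fun y => b.ev y.1 trivial U y.2 s, fun y => by
    obtain ⟨g, hg, hgs⟩ := b.exists_contMDiffAt U s y.1 trivial y.2
    have : (fun z : U => b.ev z.1 trivial U z.2 s) = fun z : U => g z :=
      funext fun z => (hgs z.1 trivial z.2).symm
    rw [this]
    exact contMDiffAt_subtype_iff.mpr hg⟩ :
      C^∞⟮𝓘(ℝ, EuclideanSpace ℝ (Fin n)), U; 𝓘(ℝ, ℝ), ℝ⟯)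
  map_one' := Subtype.ext (funext fun y => map_one (b.ev y.1 trivial U y.2))
  map_mul' s t := Subtype.ext (funext fun y => map_mul (b.ev y.1 trivial U y.2) s t)
  map_zero' := Subtype.ext (funext fun y => map_zero (b.ev y.1 trivial U y.2))
  map_add' s t := Subtype.ext (funext fun y => map_add (b.ev y.1 trivial U y.2) s t)

/-- The morphism of graded ringed spaces given by evaluation. -/
def hom : smoothSpace ℐ n M ⟶ (⟨TopCat.of M, 𝒪⟩ : GradedRingedSpace ℐ) where
  toHom :=
    { base := 𝟙 (TopCat.of M)
      c :=
        { app := fun U => RingCat.ofHom (R := 𝒪.sections (unop U))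
            (S := (smoothSheafRing 𝓘(ℝ, EuclideanSpace ℝ (Fin n)) 𝓘(ℝ, ℝ) M ℝ).presheaf.obj
              (op (unop U))) (b.toSmooth (unop U))
          naturality := fun U W i => by
            ext s
            exact smooth_ext fun x hx => b.isCompatibleAt x trivial _ _ (leOfHom i.unop) hx s } }
  map_deg U i s hs hi := smooth_ext fun x hx => b.ev_of_deg U i hi s hs x trivial hx

theorem base_hom : base b.hom = 𝟙 (TopCat.of M) := rfl

/-- Pulling back along ψ and evaluating at x is a compatible evaluation of 𝒪, so it must be the
local one. Only the ring homomorphisms of ψ enter, not its behaviour on degrees. -/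
theorem eq_hom (ψ : smoothSpace ℐ n M ⟶ (⟨TopCat.of M, 𝒪⟩ : GradedRingedSpace ℐ))
    (hψ : base ψ = 𝟙 (TopCat.of M)) : ψ = b.hom := by
  refine GradedRingedSpace.hom_ext hψ fun (U : Opens M) s => smooth_ext fun x hx => ?_
  have hU : ∀ T : Opens M, x ∈ T → x ∈ (Opens.map (base ψ)).obj T := by
    intro T hT
    rw [hψ]
    exact hT
  have hxU : x ∈ U := by
    rw [hψ] at hx
    exact hx
  let e' : ∀ T : Opens M, x ∈ T → 𝒪.sections T →+* ℝ := fun T hT =>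
    let T' : Opens M := (Opens.map (base ψ)).obj T
    (smoothEval n M x T' (hU T hT)).comp (app ψ T)
  have he' : 𝒪.IsCompatibleAt (x : M) e' := fun T W h hxW t =>
    let W' : Opens M := (Opens.map (base ψ)).obj W
    congrArg (smoothEval n M x W' (hU W hxW)) (app_res ψ h t)
  exact (b.isLocalAt x trivial).eq he' U hxU s

theorem isRealLinear_hom : IsRealLinear b.hom := fun (U : Opens M) r => smooth_ext fun x hx =>
  GradedSheaf.ringHom_algebraMap (b.ev x trivial U hx) r

/-- A germ whose image is a unit has non-zero value at x, and locality of the evaluation then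
inverts a representative near x. -/
theorem isLocal_hom : IsLocal b.hom := by
  refine fun (x : M) => ⟨fun a ha => ?_⟩
  obtain ⟨U, hx, s, rfl⟩ := 𝒪.sheaf.presheaf.exists_germ_eq (x := (x : M)) a
  obtain ⟨E, hE⟩ := (smoothEval_isCompatibleAt (ℐ := ℐ) (n := n) (x : M)).exists_stalk
  have h1 := (ha.map E).ne_zero
  erw [stalkMap_germ b.hom U x hx s, hE] at h1
  obtain ⟨W, h, hxW, hu⟩ := b.isLocalAt x trivial U hx s h1
  have h2 := hu.map (𝒪.sheaf.presheaf.germ W x hxW).hom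
  erw [𝒪.sheaf.presheaf.germ_res_apply] at h2
  exact h2

theorem exists_app_hom_eq (U : Opens M)
    (f : (smoothSheafRing 𝓘(ℝ, EuclideanSpace ℝ (Fin n)) 𝓘(ℝ, ℝ) M ℝ).presheaf.obj (op U))
    (x : M) (hx : x ∈ U) :
    ∃ (W : Opens M) (h : W ≤ U), x ∈ W ∧ ∃ s : 𝒪.sections W,
      app b.hom W s = (smoothGradedSheaf ℐ n M).res h f := by
  have hf : ContMDiff 𝓘(ℝ, EuclideanSpace ℝ (Fin n)) 𝓘(ℝ, ℝ) ∞ f.1 := f.2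
  obtain ⟨W, h, hxW, s, hs⟩ := b.exists_section U (extendZero f.1)
    (fun z hz => contMDiffAt_extendZero hz (hf ⟨z, hz⟩)) x trivial hx
  refine ⟨W, h, hxW, s, smooth_ext fun y hy => (hs y trivial hy).trans ?_⟩
  exact extendZero_of_mem f.1 (h hy)

theorem isStalkSurjective_hom : IsStalkSurjective b.hom := by
  intro (x : M) a
  obtain ⟨U, hx, f, rfl⟩ :=
    (smoothGradedSheaf ℐ n M).sheaf.presheaf.exists_germ_eq (x := (x : M)) a
  obtain ⟨W, h, hxW, s, hs⟩ := b.exists_app_hom_eq U f x hx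
  refine ⟨𝒪.sheaf.presheaf.germ W x hxW s, (stalkMap_germ b.hom W x hxW s).trans ?_⟩
  rw [hs]
  exact (smoothGradedSheaf ℐ n M).sheaf.presheaf.germ_res_apply (homOfLE h) x hxW f

/-- The base map is the identity, so α and β share their base. Every smooth function is locally the
image of a section of 𝒪, on which the two composites agree. Hence the pullbacks by α and β have
equal germs. -/
theorem mono_hom : Mono b.hom := by
  refine ⟨fun {Z} α β h => ?_⟩
  have hb : base α = base β := by
    have := congrArg base h
    exact this
  refine GradedRingedSpace.hom_ext hb fun U f => ?_
  refine TopCat.Presheaf.section_ext Z.𝒪.sheaf _ _ _ fun z hz => ?_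
  obtain ⟨W, hWU, hW, s, hs⟩ := b.exists_app_hom_eq U f (base α z) hz
  have hW' : z ∈ (Opens.map (base β)).obj W := by
    rw [← hb]
    exact hW
  have key : ∀ γ : Z ⟶ smoothSpace ℐ n M, ∀ hγ : z ∈ (Opens.map (base γ)).obj W,
      Z.𝒪.sheaf.presheaf.germ ((Opens.map (base γ)).obj U) z (hWU hγ) (app γ U f) =
        Z.𝒪.sheaf.presheaf.germ ((Opens.map (base γ)).obj W) z hγ (app (γ ≫ b.hom) W s) := by
    intro γ hγ
    rw [app_comp, hs]
    erw [app_res γ hWU f, Z.𝒪.germ_res]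
  rw [Z.𝒪.germ_res]
  refine (key α hW).trans (Eq.trans ?_ (key β hW').symm)
  -- The types of the germs depend on the morphism, so the equality of composites is substituted for
  -- a variable γ.
  have : ∀ γ : Z ⟶ (⟨TopCat.of M, 𝒪⟩ : GradedRingedSpace ℐ), γ = β ≫ b.hom →
      ∀ hγ : z ∈ (Opens.map (base γ)).obj W,
      Z.𝒪.sheaf.presheaf.germ ((Opens.map (base γ)).obj W) z hγ (app γ W s) =
        Z.𝒪.sheaf.presheaf.germ ((Opens.map (base (β ≫ b.hom))).obj W) z hW'
          (app (β ≫ b.hom) W s) := by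
    rintro _ rfl _
    rfl
  exact this _ h hW

/-- The morphism given by evaluation has all the properties of an underlying manifold. -/
theorem exists_unique_hom (b : SmoothEvaluation n 𝒪 ⊤) :
    ∃ φ : smoothSpace ℐ n M ⟶ (⟨TopCat.of M, 𝒪⟩ : GradedRingedSpace ℐ),
      base φ = 𝟙 (TopCat.of M) ∧ Mono φ ∧ IsLocal φ ∧ IsRealLinear φ ∧ IsStalkSurjective φ ∧
      ∀ ψ : smoothSpace ℐ n M ⟶ (⟨TopCat.of M, 𝒪⟩ : GradedRingedSpace ℐ),
        base ψ = 𝟙 (TopCat.of M) → ψ = φ :=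
  ⟨b.hom, b.base_hom, b.mono_hom, b.isLocal_hom, b.isRealLinear_hom, b.isStalkSurjective_hom,
    b.eq_hom⟩

end SmoothEvaluation

end Evaluation

/-! ### Evaluation on graded domains -/

section FormalEvaluation

variable {ℐ : Type*} [NonUnitalCommSemiring ℐ] (p : ℐ →+ ZMod 2)
  {V : Type} [AddCommGroup V] [Module ℝ V] (𝒱 : ℐ → Submodule ℝ V)

/-- The augmentation `S(V) → ℝ`, which sends `V` to `0`. -/
def symAugmentation : GradedSym p 𝒱 →ₐ[ℝ] ℝ :=
  (RingQuot.liftAlgHom ℝ ⟨TensorAlgebra.lift ℝ (0 : V →ₗ[ℝ] ℝ), by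
    rintro _ _ ⟨i, j, v, w, hv, hw⟩
    simp⟩ : RingQuot (SymRel p 𝒱) →ₐ[ℝ] ℝ)

variable {p 𝒱}

theorem algebraMap_symAugmentation {a : GradedSym p 𝒱} (ha : a ∈ symPow p 𝒱 0) :
    algebraMap ℝ (GradedSym p 𝒱) (symAugmentation p 𝒱 a) = a := by
  unfold symPow at ha
  rw [pow_zero, Submodule.mem_one] at ha
  obtain ⟨r, rfl⟩ := ha
  rw [AlgHom.commutes]
  rfl

/-- The only product of length zero is the empty one, which has degree 0. Hence the body vanishes on
sections of non-zero degree. -/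
theorem eq_zero_of_mem_symDeg_zero {i : ℐ} (hi : i ≠ 0) {a : GradedSym p 𝒱}
    (ha : a ∈ symDeg p 𝒱 0 i) : a = 0 := by
  suffices h : symDeg p 𝒱 0 i ≤ ⊥ from h ha
  refine Submodule.span_le.mpr ?_
  rintro _ ⟨l, hl, rfl, -⟩
  rw [List.eq_nil_of_length_eq_zero hl] at hi
  exact absurd rfl hi

variable (p 𝒱) in
/-- The value in `ℝ` of a formal power series on `V`. -/
def formalBody : FormalSym p 𝒱 →+* ℝ :=
  ((symAugmentation p 𝒱 : GradedSym p 𝒱 →+* ℝ).comp PowerSeries.constantCoeff).comp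
    (FormalSym p 𝒱).val.toRingHom

theorem formalBody_apply (f : FormalSym p 𝒱) :
    formalBody p 𝒱 f = symAugmentation p 𝒱 (PowerSeries.coeff 0 f.1) := by
  rw [PowerSeries.coeff_zero_eq_constantCoeff_apply]
  rfl

/-- The inverse of a formal power series with non-zero body. -/
def formalInv (f : FormalSym p 𝒱) (hf : formalBody p 𝒱 f ≠ 0) : PowerSeries (GradedSym p 𝒱) :=
  PowerSeries.invOfUnit f.1
    (Units.map (algebraMap ℝ (GradedSym p 𝒱)).toMonoidHom (Units.mk0 _ hf))

/-- As S^0(V) consists of scalars, a non-zero body already makes the constant coefficient a unit. -/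
theorem constantCoeff_eq (f : FormalSym p 𝒱) :
    PowerSeries.constantCoeff f.1 = algebraMap ℝ (GradedSym p 𝒱) (formalBody p 𝒱 f) := by
  rw [formalBody_apply, algebraMap_symAugmentation (f.2 0),
    PowerSeries.coeff_zero_eq_constantCoeff_apply]

theorem mul_formalInv (f : FormalSym p 𝒱) (hf : formalBody p 𝒱 f ≠ 0) :
    f.1 * formalInv f hf = 1 :=
  PowerSeries.mul_invOfUnit _ _ (constantCoeff_eq f)

theorem formalInv_mul (f : FormalSym p 𝒱) (hf : formalBody p 𝒱 f ≠ 0) :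
    formalInv f hf * f.1 = 1 :=
  PowerSeries.invOfUnit_mul _ _ (constantCoeff_eq f)

/-- The recursion for the inverse, with the inverted constant term written as a real scalar. Strong
induction on k then shows that the coefficients lie in S^k(V) and depend smoothly on the point. -/
theorem coeff_formalInv (k : ℕ) (f : FormalSym p 𝒱) (hf : formalBody p 𝒱 f ≠ 0) :
    PowerSeries.coeff k (formalInv f hf) =
      if k = 0 then algebraMap ℝ _ (formalBody p 𝒱 f)⁻¹
      else (-(formalBody p 𝒱 f)⁻¹) • ∑ x ∈ Finset.HasAntidiagonal.antidiagonal k,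
        if x.2 < k then PowerSeries.coeff x.1 f.1 * PowerSeries.coeff x.2 (formalInv f hf)
        else 0 := by
  have h : ((Units.map (algebraMap ℝ (GradedSym p 𝒱)).toMonoidHom (Units.mk0 _ hf))⁻¹ :
      (GradedSym p 𝒱)ˣ).1 = algebraMap ℝ _ (formalBody p 𝒱 f)⁻¹ := rfl
  unfold formalInv
  rw [PowerSeries.coeff_invOfUnit, h, neg_smul, Algebra.smul_def, neg_mul]

theorem coeff_formalInv_mem (k : ℕ) (f : FormalSym p 𝒱) (hf : formalBody p 𝒱 f ≠ 0) :
    PowerSeries.coeff k (formalInv f hf) ∈ symPow p 𝒱 k := by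
  induction k using Nat.strong_induction_on with
  | _ k ih =>
    rw [coeff_formalInv]
    split_ifs with hk
    · subst hk
      unfold symPow
      rw [pow_zero]
      exact Submodule.algebraMap_mem _
    · refine Submodule.smul_mem _ _ (Submodule.sum_mem _ fun x hx => ?_)
      split_ifs with hxk
      · rw [← Finset.HasAntidiagonal.mem_antidiagonal.mp hx]
        have h1 := f.2 x.1
        have h2 := ih x.2 hxk
        unfold symPow at h1 h2 ⊢
        rw [pow_add]
        exact Submodule.mul_mem_mul h1 h2
      · exact zero_mem _

variable {n : ℕ} {N : Type} [TopologicalSpace N] [ChartedSpace (EuclideanSpace ℝ (Fin n)) N]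
  [FiniteDimensional ℝ V]

/-- Expanding a in a basis of the finite-dimensional S^m(V) turns l(ab) into a finite sum of
products of smooth real functions. -/
theorem contMDiff_mul_of_mem_symPow {a b : N → GradedSym p 𝒱} {m : ℕ}
    (ha : ∀ x, a x ∈ symPow p 𝒱 m)
    (hsa : ∀ l : Module.Dual ℝ (GradedSym p 𝒱),
      ContMDiff 𝓘(ℝ, EuclideanSpace ℝ (Fin n)) 𝓘(ℝ, ℝ) ∞ fun x => l (a x))
    (hsb : ∀ l : Module.Dual ℝ (GradedSym p 𝒱),
      ContMDiff 𝓘(ℝ, EuclideanSpace ℝ (Fin n)) 𝓘(ℝ, ℝ) ∞ fun x => l (b x))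
    (l : Module.Dual ℝ (GradedSym p 𝒱)) :
    ContMDiff 𝓘(ℝ, EuclideanSpace ℝ (Fin n)) 𝓘(ℝ, ℝ) ∞ fun x => l (a x * b x) := by
  obtain ⟨k, e, d, hd⟩ := symPow_expansion (p := p) (𝒱 := 𝒱) m
  have h : ∀ x, l (a x * b x) = ∑ t, d t (a x) * (l ∘ₗ LinearMap.mulLeft ℝ (e t)) (b x) := by
    intro x
    conv_lhs => rw [hd _ (ha x)]
    simp [Finset.sum_mul]
  simp only [h]
  exact contMDiff_finsetSum fun t _ => (hsa (d t)).mul (hsb _)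

theorem contMDiff_coeff_formalInv {f : N → FormalSym p 𝒱}
    (hs : ∀ (k : ℕ) (l : Module.Dual ℝ (GradedSym p 𝒱)),
      ContMDiff 𝓘(ℝ, EuclideanSpace ℝ (Fin n)) 𝓘(ℝ, ℝ) ∞ fun x => l (PowerSeries.coeff k (f x).1))
    (hf : ∀ x, formalBody p 𝒱 (f x) ≠ 0) (k : ℕ) (l : Module.Dual ℝ (GradedSym p 𝒱)) :
    ContMDiff 𝓘(ℝ, EuclideanSpace ℝ (Fin n)) 𝓘(ℝ, ℝ) ∞
      fun x => l (PowerSeries.coeff k (formalInv (f x) (hf x))) := by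
  have hinv : ContMDiff 𝓘(ℝ, EuclideanSpace ℝ (Fin n)) 𝓘(ℝ, ℝ) ∞
      fun x => (formalBody p 𝒱 (f x))⁻¹ := by
    have h0 : ContMDiff 𝓘(ℝ, EuclideanSpace ℝ (Fin n)) 𝓘(ℝ, ℝ) ∞
        fun x => formalBody p 𝒱 (f x) := by
      simp only [formalBody_apply]
      exact hs 0 (symAugmentation p 𝒱).toLinearMap
    exact fun x => ((contDiffAt_inv ℝ (hf x)).contMDiffAt).comp x (h0 x)
  induction k using Nat.strong_induction_on generalizing l with
  | _ k ih =>
    simp only [fun x => coeff_formalInv k (f x) (hf x)]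
    split_ifs with hk
    · simp only [Algebra.algebraMap_eq_smul_one, map_smul, smul_eq_mul]
      exact hinv.mul contMDiff_const
    · simp only [map_smul, smul_eq_mul, map_sum]
      refine hinv.neg.mul (contMDiff_finsetSum fun y _ => ?_)
      split_ifs with hy
      · exact contMDiff_mul_of_mem_symPow (fun x => (f x).2 y.1) (hs y.1) (ih y.2 hy) l
      · simp only [map_zero]
        exact contMDiff_const

theorem contMDiff_formalEval {U : Opens N} (s : formalSections n N p 𝒱 U) :
    ContMDiff 𝓘(ℝ, EuclideanSpace ℝ (Fin n)) 𝓘(ℝ, ℝ) ∞ fun x : U => formalBody p 𝒱 (s.1 x) := by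
  simp only [formalBody_apply]
  exact s.2 0 (symAugmentation p 𝒱).toLinearMap

variable [DecidableEq ℐ] [DirectSum.Decomposition 𝒱]

variable (n N p 𝒱) in
/-- The evaluation of formal sections. -/
def formalEval (x : N) (U : Opens N) (hx : x ∈ U) :
    (formalGradedSheaf n N p 𝒱).sections U →+* ℝ :=
  ((formalBody p 𝒱).comp (Pi.evalRingHom (fun _ : U => FormalSym p 𝒱) ⟨x, hx⟩)).comp
    (formalSections n N p 𝒱 U).val.toRingHom

theorem formalEval_isLocalAt (x : N) :
    (formalGradedSheaf n N p 𝒱).IsLocalAt (x : N) (formalEval p 𝒱 n N x) := by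
  intro U hx s hs
  let f : formalSections n N p 𝒱 U := s
  let W : Opens N := ⟨Subtype.val '' ((fun x : U => formalBody p 𝒱 (f.1 x)) ⁻¹' {0}ᶜ),
    U.2.isOpenMap_subtype_val _
      (isOpen_compl_singleton.preimage (contMDiff_formalEval f).continuous)⟩
  have hWU : W ≤ U := by
    rintro _ ⟨y, -, rfl⟩
    exact y.2
  have hW : ∀ y : W, formalBody p 𝒱 (f.1 ⟨y.1, hWU y.2⟩) ≠ 0 := by
    rintro ⟨_, y, hy, rfl⟩
    exact hy
  let g : formalSections n N p 𝒱 W :=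
    ⟨fun y => ⟨formalInv _ (hW y), fun k => coeff_formalInv_mem k _ _⟩,
      contMDiff_coeff_formalInv (f := fun y : W => f.1 ⟨y.1, hWU y.2⟩)
        (fun k l => (f.2 k l).comp (contMDiff_inclusion hWU)) hW⟩
  refine ⟨W, hWU, ⟨⟨x, hx⟩, hs, rfl⟩,
    ⟨(formalGradedSheaf n N p 𝒱).res hWU s, g, ?_, ?_⟩, rfl⟩
  · exact Subtype.ext (funext fun y => Subtype.ext (mul_formalInv _ (hW y)))
  · exact Subtype.ext (funext fun y => Subtype.ext (formalInv_mul _ (hW y)))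

variable (n N p 𝒱) in
/-- The evaluation of formal sections as a smooth evaluation. -/
def formalEvaluation : SmoothEvaluation n (formalGradedSheaf n N p 𝒱) ⊤ where
  ev x _ := formalEval p 𝒱 n N x
  isCompatibleAt _ _ _ _ _ _ _ := rfl
  isLocalAt x _ := formalEval_isLocalAt x
  ev_of_deg U i hi s hs x _ hx := by
    refine (formalBody_apply (s.1 ⟨x, hx⟩ : FormalSym p 𝒱)).trans ?_
    exact (congrArg _ (eq_zero_of_mem_symDeg_zero hi (hs ⟨x, hx⟩ 0))).trans (map_zero _)
  exists_contMDiffAt U s x _ hx :=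
    ⟨_, contMDiffAt_extendZero hx (contMDiff_formalEval s ⟨x, hx⟩), fun _ _ hz => extendZero_of_mem _ hz⟩
  exists_section U f hf x _ hx := by
    -- On a domain, f lifts to f · 1 without shrinking U.
    refine ⟨U, le_rfl, hx, (⟨fun y => algebraMap ℝ _ (f y), fun k l => ?_⟩ :
      formalSections n N p 𝒱 U), fun z _ _ => ?_⟩
    · have h : ∀ r : ℝ, l (PowerSeries.coeff k (algebraMap ℝ (FormalSym p 𝒱) r).1) =
          r * l (PowerSeries.coeff k 1) := by
        intro r
        rw [Algebra.algebraMap_eq_smul_one, ← smul_eq_mul, ← map_smul, ← PowerSeries.coeff_smul]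
        rfl
      simp only [h]
      exact (contMDiff_of_contMDiffAt hf fun _ => rfl).mul contMDiff_const
    · exact RingHom.congr_fun
        (Subsingleton.elim ((formalBody p 𝒱).comp (algebraMap ℝ (FormalSym p 𝒱))) (RingHom.id ℝ)) _

end FormalEvaluation

/-! ### Evaluation on graded manifolds -/

section Chart

open GradedRingedSpace

variable {ℐ : Type*} [NonUnitalCommSemiring ℐ] {n : ℕ}
  {M : Type} [TopologicalSpace M] [ChartedSpace (EuclideanSpace ℝ (Fin n)) M]
  {N : Type} [TopologicalSpace N] [ChartedSpace (EuclideanSpace ℝ (Fin n)) N]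

/-- A smooth evaluation is transported along a chart. -/
theorem SmoothEvaluation.nonempty_of_iso {𝒪 : GradedSheaf ℐ (TopCat.of M)} {U₀ : Opens M}
    {𝒪' : GradedSheaf ℐ (TopCat.of N)} (b : SmoothEvaluation n 𝒪' ⊤)
    (χ : (⟨TopCat.of U₀, 𝒪.restrict U₀⟩ : GradedRingedSpace ℐ) ≅ ⟨TopCat.of N, 𝒪'⟩)
    (hχ : ContMDiff (M := U₀) (M' := N) 𝓘(ℝ, EuclideanSpace ℝ (Fin n))
      𝓘(ℝ, EuclideanSpace ℝ (Fin n)) ∞ (base χ.hom).hom)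
    (hχ' : ContMDiff (M := N) (M' := U₀) 𝓘(ℝ, EuclideanSpace ℝ (Fin n))
      𝓘(ℝ, EuclideanSpace ℝ (Fin n)) ∞ (base χ.inv).hom) :
    Nonempty (SmoothEvaluation n 𝒪 U₀) := by
  let a : U₀ → N := (base χ.hom).hom
  let c : N → U₀ := (base χ.inv).hom
  have hca : ∀ u, c (a u) = u := fun u =>
    ConcreteCategory.congr_hom (congrArg base χ.hom_inv_id) u
  have hac : ∀ w, a (c w) = w := fun w =>
    ConcreteCategory.congr_hom (congrArg base χ.inv_hom_id) w
  let pre : Opens M → Opens U₀ := fun V => ⟨Subtype.val ⁻¹' V, V.2.preimage continuous_subtype_val⟩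
  let img : Opens U₀ → Opens M := fun T =>
    (Opens.isOpenEmbedding (X := TopCat.of M) U₀).isOpenMap.functor.obj T
  have img_pre : ∀ V, img (pre V) ≤ V := by
    rintro V _ ⟨y, hy, rfl⟩
    exact hy
  let B : Opens M → Opens N := fun V => (Opens.map (base χ.inv)).obj (pre V)
  have hB : ∀ (y : M) (h₀ : y ∈ U₀) (V : Opens M), y ∈ V → a ⟨y, h₀⟩ ∈ B V := by
    intro y h₀ V hV
    change (c (a ⟨y, h₀⟩)).1 ∈ V
    rw [hca]
    exact hV
  have hBV : ∀ (V : Opens M) (u : U₀), a u ∈ B V → u.1 ∈ V := by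
    intro V u hu
    have : (c (a u)).1 ∈ V := hu
    rwa [hca] at this
  -- θ restricts a section to V ∩ U₀ and reads it in the chart, where `b` can evaluate it.
  let θ : ∀ V : Opens M, 𝒪.sections V →+* 𝒪'.sections (B V) := fun V =>
    (app χ.inv (pre V)).comp (𝒪.res (img_pre V))
  have hθ : ∀ (V W : Opens M) (h : W ≤ V) (s : 𝒪.sections V),
      θ W (𝒪.res h s) = 𝒪'.res (fun _ hx => h hx) (θ V s) := by
    intro V W h s
    have h1 : pre W ≤ pre V := fun _ hx => h hx
    refine Eq.trans ?_ (app_res χ.inv h1 (𝒪.res (img_pre V) s))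
    refine congrArg (app χ.inv (pre W)) ((𝒪.res_res _ _ s).trans ?_)
    exact (𝒪.res_res (img_pre V) (Set.image_mono h1) s).symm
  refine ⟨{
    ev := fun y h₀ V hV => (b.ev (a ⟨y, h₀⟩) trivial (B V) (hB y h₀ V hV)).comp (θ V)
    isCompatibleAt := fun y h₀ V W h hW s => ?_
    isLocalAt := fun y h₀ V hV s hs => ?_
    ev_of_deg := fun V i hi s hs y h₀ hV => b.ev_of_deg _ i hi _
      (χ.inv.map_deg _ i _ (𝒪.map_deg _ i s hs)) _ _ _
    exists_contMDiffAt := fun V s y h₀ hV => ?_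
    exists_section := fun V f hf y h₀ hV => ?_ }⟩
  · refine (congrArg (b.ev _ trivial (B W) (hB y h₀ W hW)) (hθ V W h s)).trans ?_
    exact b.isCompatibleAt _ trivial _ _ _ _ _
  · obtain ⟨W, hWB, hyW, hu⟩ := b.isLocalAt _ trivial (B V) (hB y h₀ V hV) (θ V s) hs
    have hWV : img ((Opens.map (base χ.hom)).obj W) ≤ V := by
      rintro _ ⟨z, hz, rfl⟩
      exact hBV V z (hWB hz)
    refine ⟨img ((Opens.map (base χ.hom)).obj W), hWV, ⟨⟨y, h₀⟩, hyW, rfl⟩, ?_⟩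
    -- Going to the chart and back is restriction, so the inverse found on W pulls back to an
    -- inverse of s.
    have h1 : app χ.hom W (𝒪'.res hWB (θ V s)) = 𝒪.res hWV s := by
      refine (app_res χ.hom hWB _).trans ((congrArg _
        (app_of_eq_id χ.hom_inv_id (pre V) (𝒪.res (img_pre V) s))).trans ?_)
      refine (GradedSheaf.res_res _ _ _ _).trans ?_
      exact 𝒪.res_res (T := img ((Opens.map (base χ.hom)).obj W)) (img_pre V)
        (Set.image_mono fun u hu => hBV V u (hWB hu)) s
    rw [← h1]
    exact hu.map (app χ.hom W)
  · obtain ⟨g, hg, hgs⟩ := b.exists_contMDiffAt (B V) (θ V s) _ trivial (hB y h₀ V hV)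
    refine ⟨extendZero fun u : U₀ => g (a u),
      contMDiffAt_extendZero h₀ (hg.comp (⟨y, h₀⟩ : U₀) (hχ _)), fun z hz₀ hz => ?_⟩
    rw [extendZero_of_mem _ hz₀]
    exact hgs _ trivial (hB z hz₀ V hz)
  · obtain ⟨W, hWB, hyW, s, hs⟩ := b.exists_section (B V) (fun w => f (c w)) (fun w hw =>
      (contMDiffAt_subtype_iff.mpr (hf (c w) hw)).comp w (hχ' w)) _ trivial (hB y h₀ V hV)
    have hWV : img ((Opens.map (base χ.hom)).obj W) ≤ V := by
      rintro _ ⟨z, hz, rfl⟩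
      exact hBV V z (hWB hz)
    refine ⟨img ((Opens.map (base χ.hom)).obj W), hWV, ⟨⟨y, h₀⟩, hyW, rfl⟩,
      app χ.hom W s, ?_⟩
    rintro z hz₀ ⟨z', hz', rfl⟩
    have hpre : pre (img ((Opens.map (base χ.hom)).obj W)) ≤ (Opens.map (base χ.hom)).obj W := by
      rintro u ⟨u', hu', hu⟩
      rwa [← Subtype.ext hu]
    have h1 : B (img ((Opens.map (base χ.hom)).obj W)) ≤ W := by
      intro w hw
      have : a (c w) ∈ W := hpre hw
      rwa [hac] at this
    have h2 : θ (img ((Opens.map (base χ.hom)).obj W)) (app χ.hom W s) = 𝒪'.res h1 s := by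
      refine (app_res χ.inv hpre (app χ.hom W s)).trans ?_
      rw [← app_comp]
      erw [app_of_eq_id χ.inv_hom_id W s]
      exact 𝒪'.res_res _ _ s
    refine (congrArg (b.ev _ trivial _ _) h2).trans ?_
    refine (b.isCompatibleAt _ trivial _ _ h1 _ s).trans ((hs (a z') trivial hz').trans ?_)
    exact congrArg (fun u : U₀ => f u) (hca z')

theorem IsGradedManifold.nonempty_smoothEvaluation {p : ℐ →+ ZMod 2} {V : Type} [AddCommGroup V]
    [Module ℝ V] [FiniteDimensional ℝ V] {𝒱 : ℐ → Submodule ℝ V} [DecidableEq ℐ]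
    [DirectSum.Decomposition 𝒱] {𝒪 : GradedSheaf ℐ (TopCat.of M)}
    (h : IsGradedManifold n p 𝒱 M 𝒪) : Nonempty (SmoothEvaluation n 𝒪 ⊤) := by
  refine SmoothEvaluation.nonempty_of_locally fun x => ?_
  obtain ⟨U, hx, W, χ, hχ, hχ'⟩ := h x
  exact ⟨U, hx, (formalEvaluation p 𝒱 n W).nonempty_of_iso χ hχ hχ'⟩

end Chart

end

theorem mainTheorem4
    {ℐ : Type*} [NonUnitalCommSemiring ℐ] [IsCancelAdd ℐ] [Countable ℐ] [DecidableEq ℐ]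
    (p : ℐ →+ ZMod 2) (hp : p ≠ 0)
    {V : Type} [AddCommGroup V] [Module ℝ V] [FiniteDimensional ℝ V]
    (𝒱 : ℐ → Submodule ℝ V) [DirectSum.Decomposition 𝒱] (h𝒱 : 𝒱 0 = ⊥) (n : ℕ) :
    -- graded domains
    (∀ U : Opens (EuclideanSpace ℝ (Fin n)),
      ∃ φ : smoothSpace ℐ n U ⟶ gradedDomain n p 𝒱 U,
        GradedRingedSpace.base φ = 𝟙 (TopCat.of U) ∧ Mono φ ∧
        GradedRingedSpace.IsLocal φ ∧ GradedRingedSpace.IsRealLinear φ ∧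
        GradedRingedSpace.IsStalkSurjective φ ∧
        ∀ ψ : smoothSpace ℐ n U ⟶ gradedDomain n p 𝒱 U,
          GradedRingedSpace.base ψ = 𝟙 (TopCat.of U) → ψ = φ) ∧
    -- graded manifolds
    (∀ (M : Type) [TopologicalSpace M] [ChartedSpace (EuclideanSpace ℝ (Fin n)) M]
      [IsManifold 𝓘(ℝ, EuclideanSpace ℝ (Fin n)) ∞ M] (𝒪 : GradedSheaf ℐ (TopCat.of M)),
      IsGradedManifold n p 𝒱 M 𝒪 →
      ∃ φ : smoothSpace ℐ n M ⟶ (⟨TopCat.of M, 𝒪⟩ : GradedRingedSpace ℐ),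
        GradedRingedSpace.base φ = 𝟙 (TopCat.of M) ∧ Mono φ ∧
        GradedRingedSpace.IsLocal φ ∧ GradedRingedSpace.IsRealLinear φ ∧
        GradedRingedSpace.IsStalkSurjective φ ∧
        ∀ ψ : smoothSpace ℐ n M ⟶ (⟨TopCat.of M, 𝒪⟩ : GradedRingedSpace ℐ),
          GradedRingedSpace.base ψ = 𝟙 (TopCat.of M) → ψ = φ) ∧
    -- endomorphisms of the sheaf of rings of smooth functions
    (∀ (M : Type) [TopologicalSpace M] [ChartedSpace (EuclideanSpace ℝ (Fin n)) M]
      [IsManifold 𝓘(ℝ, EuclideanSpace ℝ (Fin n)) ∞ M]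
      (F : smoothSheafRing 𝓘(ℝ, EuclideanSpace ℝ (Fin n)) 𝓘(ℝ, ℝ) M ℝ ⟶
        smoothSheafRing 𝓘(ℝ, EuclideanSpace ℝ (Fin n)) 𝓘(ℝ, ℝ) M ℝ), F = 𝟙 _) :=
  ⟨fun U => (formalEvaluation p 𝒱 n U).exists_unique_hom,
    fun _ _ _ _ _ h𝒪 => h𝒪.nonempty_smoothEvaluation.some.exists_unique_hom,
    fun _ _ _ _ F => smoothSheafRing_hom_eq_id F⟩
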